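/- Let $N, d$ be natural numbers and let $\Sigma_1,\ldots,\Sigma_d$ and $U_1,\ldots,U_d$ be random $N\times N$ matrices on a common probability space, all $2d$ of them independent, where each $\Sigma_j$ is a uniform permutation matrix (each of the $N!$ permutation matrices has probability $1/N!$) and each $U_j$ is a Haar unitary matrix (distributed according to the normalized Haar measure on the unitary group $U(N)$). Let $A_1,\ldots,A_d$ be (deterministic) diagonal $N\times N$ matrices with complex entries, and write $$A_j^u := U_jA_jU_j^{-1}, \qquad A_j^s := \Sigma_jA_j\Sigma_j^{-1}.$$ For a square matrix $M$ and $z\in\mathbb{C}$, $\det(z-M)$ denotes $\det(zI-M)$, and for $0\le k\le N$, $[M]_k$ denotes the top-left $k\times k$ corner of an $N\times N$ matrix $M$. Then for every $z\in\mathbb{C}$ all the random variables below are integrable, and $$\mathbf{E}\left[\det\left(z-(A_1^u+\cdots+A_d^u)\right)\right]=\mathbf{E}\left[\det\left(z-(A_1^s+\cdots+A_d^s)\right)\right],$$ $$\mathbf{E}\left[\det\left(z-A_1^u A_2^u\cdots A_d^u\right)\right]=\mathbf{E}\left[\det\left(z-A_1^s A_2^s\cdots A_d^s\right)\right],$$ and,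 for every $1\le j\le d$ and every $0\le k\le N$, $$\mathbf{E}\left[\det\left(z-[A_j^u]_k\right)\right]=\mathbf{E}\left[\det\left(z-[A_j^s]_k\right)\right].$$ -/

import Mathlib

open MeasureTheory ProbabilityTheory

/-- Entrywise (equivalently, Borel) measurable structure on complex matrices. -/
noncomputable instance matrixMeasurableSpace (m n : Type*) : MeasurableSpace (Matrix m n ℂ) :=
  (MeasurableSpace.pi : MeasurableSpace (m → n → ℂ))

instance matrixBorelSpace (m n : Type*) [Countable m] [Countable n] :
    BorelSpace (Matrix m n ℂ) :=
  inferInstanceAs (BorelSpace (m → n → ℂ))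

instance unitaryGroup_compactSpace (N : ℕ) : CompactSpace (Matrix.unitaryGroup (Fin N) ℂ) := by
  refine isCompact_iff_compactSpace.mp ?_
  have hK : IsCompact {M : Matrix (Fin N) (Fin N) ℂ | ∀ i, M i ∈ {v : Fin N → ℂ |
      ∀ j, v j ∈ Metric.closedBall (0 : ℂ) 1}} :=
    isCompact_pi_infinite fun _ => isCompact_pi_infinite fun _ => isCompact_closedBall 0 1
  refine hK.of_isClosed_subset isClosed_unitary ?_
  intro M hM i j
  simpa using entry_norm_bound_of_unitary hM i j

/-- The law on `N × N` complex matrices of a Haar unitary matrix: the push-forward, under the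
inclusion of the unitary group into the matrices, of the Haar measure of total mass one. -/
noncomputable def haarUnitaryLaw (N : ℕ) : Measure (Matrix (Fin N) (Fin N) ℂ) :=
  (Measure.haarMeasure (⊤ : TopologicalSpace.PositiveCompacts (Matrix.unitaryGroup (Fin N) ℂ))).map
    Subtype.val

/-- The law on `N × N` complex matrices of a uniform permutation matrix:
each of the `N!` permutation matrices has mass `1 / N!`. -/
noncomputable def uniformPermLaw (N : ℕ) : Measure (Matrix (Fin N) (Fin N) ℂ) :=
  ((N.factorial : ENNReal)⁻¹) • ∑ σ : Equiv.Perm (Fin N), Measure.dirac (σ.permMatrix ℂ)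

/-- The conjugate `V A V⁻¹`. -/
noncomputable def conjBy {N : ℕ} (V A : Matrix (Fin N) (Fin N) ℂ) : Matrix (Fin N) (Fin N) ℂ :=
  V * A * V⁻¹

/-- `det (z - M)`. -/
def charDet {n : ℕ} (z : ℂ) (M : Matrix (Fin n) (Fin n) ℂ) : ℂ :=
  (z • (1 : Matrix (Fin n) (Fin n) ℂ) - M).det

/-- The top-left `k × k` corner of an `N × N` matrix. -/
def topLeft {N k : ℕ} (hk : k ≤ N) (M : Matrix (Fin N) (Fin N) ℂ) : Matrix (Fin k) (Fin k) ℂ :=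
  M.submatrix (Fin.castLE hk) (Fin.castLE hk)

/-- The random variables `X` and `Y` are both integrable and have the same expectation. -/
def SameExpectation {Ω : Type*} [MeasurableSpace Ω] (P : Measure Ω) (X Y : Ω → ℂ) : Prop :=
  Integrable X P ∧ Integrable Y P ∧ ∫ ω, X ω ∂P = ∫ ω, Y ω ∂P

/-! With all but one conjugate fixed, each of the three polynomials is `det (B + C * X * R)` in the
remaining conjugate `X`, hence a linear combination `f` of minors of `X`
(`det_add_mul_mul_mem_minorSpan`).

Sum such an `f` over conjugation by signed permutation matrices. The signs kill every minor whose
row and column sets differ; the permutations turn a principal minor of order `k` into a multiple of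
the sum of all of them, which is a conjugation invariant. So the sum takes the same value at `U A
U⁻¹` as at `A` (`sum_signedConj_conj`). Haar invariance inserts this average without changing the
unitary expectation, and at a diagonal `A` the signs cancel, leaving the permutation average
(`integral_haarUnitaryLaw_eq_uniformPermLaw`).

By independence the joint laws are products, so Fubini exchanges the factors one at a time
(`integral_pi_eq_of_separately`); compact supports give integrability. -/

/-- The span of the minors `X ↦ det (X.submatrix r c)`, as functions of an `N × N` matrix. -/
def minorSpan (N : ℕ) : Submodule ℂ (Matrix (Fin N) (Fin N) ℂ → ℂ) :=
  Submodule.span ℂ {f | ∃ (k : ℕ) (r c : Fin k → Fin N), f = fun X => (X.submatrix r c).det}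

theorem minor_mem_minorSpan {N k : ℕ} (r c : Fin k → Fin N) :
    (fun X : Matrix (Fin N) (Fin N) ℂ => (X.submatrix r c).det) ∈ minorSpan N :=
  Submodule.subset_span ⟨k, r, c, rfl⟩

/-- Expansion of the determinant of a product of rectangular matrices by rows. -/
theorem det_mul_eq_sum_submatrix_rows {m n : ℕ} (C : Matrix (Fin n) (Fin m) ℂ)
    (Y : Matrix (Fin m) (Fin n) ℂ) :
    (C * Y).det = ∑ r : Fin n → Fin m, (∏ i, C i (r i)) * (Y.submatrix r id).det := by
  have h : (C * Y : Matrix (Fin n) (Fin n) ℂ) = fun i => ∑ a, C i a • Y a := by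
    ext i j
    simp [Matrix.mul_apply]
  have h2 := (Matrix.detRowAlternating (n := Fin n) (R := ℂ)).toMultilinearMap.map_sum
    (fun i a => C i a • Y a)
  rw [h]
  refine h2.trans (Finset.sum_congr rfl fun r _ => ?_)
  exact (Matrix.detRowAlternating (n := Fin n) (R := ℂ)).toMultilinearMap.map_smul_univ _ _

/-- Expansion of the determinant of a product of rectangular matrices by columns. -/
theorem det_mul_eq_sum_submatrix_cols {m n : ℕ} (Y : Matrix (Fin n) (Fin m) ℂ)
    (R : Matrix (Fin m) (Fin n) ℂ) :
    (Y * R).det = ∑ c : Fin n → Fin m, (∏ i, R (c i) i) * (Y.submatrix id c).det := by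
  rw [← Matrix.det_transpose, Matrix.transpose_mul, det_mul_eq_sum_submatrix_rows]
  refine Finset.sum_congr rfl fun c _ => ?_
  rw [← Matrix.det_transpose (Y.submatrix id c)]
  rfl

theorem det_mul_mul_mem_minorSpan {N n : ℕ} (C : Matrix (Fin n) (Fin N) ℂ)
    (R : Matrix (Fin N) (Fin n) ℂ) :
    (fun X : Matrix (Fin N) (Fin N) ℂ => (C * X * R).det) ∈ minorSpan N := by
  have h : (fun X : Matrix (Fin N) (Fin N) ℂ => (C * X * R).det) =
      ∑ r : Fin n → Fin N, ∑ c : Fin n → Fin N, ((∏ i, C i (r i)) * ∏ i, R (c i) i) •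
        fun X : Matrix (Fin N) (Fin N) ℂ => (X.submatrix r c).det := by
    ext X
    rw [Matrix.mul_assoc, det_mul_eq_sum_submatrix_rows]
    simp only [Finset.sum_apply, Pi.smul_apply, smul_eq_mul]
    refine Finset.sum_congr rfl fun r _ => ?_
    have : (X * R).submatrix r id = X.submatrix r id * R := rfl
    rw [this, det_mul_eq_sum_submatrix_cols, Finset.mul_sum]
    refine Finset.sum_congr rfl fun c _ => ?_
    rw [Matrix.submatrix_submatrix]
    simp [mul_assoc]
  rw [h]
  exact Submodule.sum_mem _ fun r _ => Submodule.sum_mem _ fun c _ =>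
    Submodule.smul_mem _ _ (minor_mem_minorSpan r c)

/-- Laplace expansion removes the rows taken from `B` one by one, until only `det (C * X * R)` is
left. The size `n` drops while `X` stays `N × N`, so `C` and `R` must be rectangular. -/
theorem det_piecewise_mem_minorSpan {N : ℕ} (n : ℕ) (S : Finset (Fin n))
    (B : Matrix (Fin n) (Fin n) ℂ) (C : Matrix (Fin n) (Fin N) ℂ) (R : Matrix (Fin N) (Fin n) ℂ) :
    (fun X : Matrix (Fin N) (Fin N) ℂ =>
      (Matrix.of fun i j => if i ∈ S then B i j else (C * X * R) i j).det) ∈ minorSpan N := by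
  induction n with
  | zero =>
    convert det_mul_mul_mem_minorSpan C R using 2 with X
    simp
  | succ n ih =>
    rcases S.eq_empty_or_nonempty with rfl | ⟨i, hi⟩
    · exact det_mul_mul_mem_minorSpan C R
    · have h : (fun X : Matrix (Fin N) (Fin N) ℂ =>
          (Matrix.of fun i j => if i ∈ S then B i j else (C * X * R) i j).det) =
          ∑ j : Fin (n + 1), ((-1) ^ (i + j : ℕ) * B i j) •
            fun X : Matrix (Fin N) (Fin N) ℂ => (Matrix.of fun i' j' =>
              if i' ∈ Finset.univ.filter (fun l => i.succAbove l ∈ S)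
              then B.submatrix i.succAbove j.succAbove i' j'
              else (C.submatrix i.succAbove id * X * R.submatrix id j.succAbove) i' j').det := by
        ext X
        rw [Matrix.det_succ_row _ i]
        simp only [Finset.sum_apply, Pi.smul_apply, smul_eq_mul]
        refine Finset.sum_congr rfl fun j _ => ?_
        congr 1
        · simp [hi]
        · congr 1
          ext i' j'
          simp only [Matrix.submatrix_apply, Matrix.of_apply, Finset.mem_filter,
            Finset.mem_univ, true_and]
          rfl
      rw [h]
      exact Submodule.sum_mem _ fun j _ => Submodule.smul_mem _ _ (ih _ _ _ _)

theorem det_add_mul_mul_mem_minorSpan {N n : ℕ} (B : Matrix (Fin n) (Fin n) ℂ)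
    (C : Matrix (Fin n) (Fin N) ℂ) (R : Matrix (Fin N) (Fin n) ℂ) :
    (fun X : Matrix (Fin N) (Fin N) ℂ => (B + C * X * R).det) ∈ minorSpan N := by
  have h : (fun X : Matrix (Fin N) (Fin N) ℂ => (B + C * X * R).det) =
      ∑ S : Finset (Fin n), fun X : Matrix (Fin N) (Fin N) ℂ =>
        (Matrix.of fun i j => if i ∈ S then B i j else (C * X * R) i j).det := by
    ext X
    rw [Finset.sum_apply]
    refine ((Matrix.detRowAlternating (n := Fin n) (R := ℂ)).toMultilinearMap.map_add_univ
      B (C * X * R)).trans (Finset.sum_congr rfl fun S _ => ?_)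
    refine congrArg Matrix.det ?_
    ext i j
    simp only [Matrix.of_apply, Finset.piecewise]
    split_ifs <;> rfl
  rw [h]
  exact Submodule.sum_mem _ fun S _ => det_piecewise_mem_minorSpan n S B C R

theorem continuous_of_mem_minorSpan {N : ℕ} {f : Matrix (Fin N) (Fin N) ℂ → ℂ}
    (hf : f ∈ minorSpan N) : Continuous f := by
  induction hf using Submodule.span_induction with
  | mem f hf =>
    obtain ⟨k, r, c, rfl⟩ := hf
    exact (continuous_id.matrix_submatrix r c).matrix_det
  | zero => exact continuous_const
  | add f g _ _ hf hg => exact hf.add hg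
  | smul a f _ hf => exact hf.const_smul a

/-! ### Averaging minors over signed permutations -/

theorem det_submatrix_eq_zero_of_not_injective_left {N k : ℕ} (X : Matrix (Fin N) (Fin N) ℂ)
    {r : Fin k → Fin N} (hr : ¬ Function.Injective r) (c : Fin k → Fin N) :
    (X.submatrix r c).det = 0 := by
  simp only [Function.Injective, not_forall] at hr
  obtain ⟨i, j, hij, hne⟩ := hr
  exact Matrix.det_zero_of_row_eq hne (by ext l; simp [hij])

theorem det_submatrix_eq_zero_of_not_injective_right {N k : ℕ} (X : Matrix (Fin N) (Fin N) ℂ)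
    (r : Fin k → Fin N) {c : Fin k → Fin N} (hc : ¬ Function.Injective c) :
    (X.submatrix r c).det = 0 := by
  rw [← Matrix.det_transpose]
  exact det_submatrix_eq_zero_of_not_injective_left X.transpose hc r

/-- Expanding one side by rows and the other by columns gives the same double sum. Up to sign, each
side is `k!` times a coefficient of the characteristic polynomial. -/
theorem sum_principal_minors_mul_comm {N : ℕ} (k : ℕ) (X Y : Matrix (Fin N) (Fin N) ℂ) :
    ∑ r : Fin k → Fin N, ((X * Y).submatrix r r).det =
      ∑ r : Fin k → Fin N, ((Y * X).submatrix r r).det := by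
  have h1 (r : Fin k → Fin N) : ((X * Y).submatrix r r).det =
      ∑ s : Fin k → Fin N, (∏ i, X (r i) (s i)) * (Y.submatrix s r).det :=
    det_mul_eq_sum_submatrix_rows (X.submatrix r id) (Y.submatrix id r)
  have h2 (s : Fin k → Fin N) : ((Y * X).submatrix s s).det =
      ∑ r : Fin k → Fin N, (∏ i, X (r i) (s i)) * (Y.submatrix s r).det :=
    det_mul_eq_sum_submatrix_cols (Y.submatrix s id) (X.submatrix id s)
  simp_rw [h1, h2]
  exact Finset.sum_comm

/-- Averaging a principal minor over all permutations gives a multiple of the sum of all principal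
minors of the same order. -/
theorem card_mul_sum_perm_principal_minor {N k : ℕ} (X : Matrix (Fin N) (Fin N) ℂ)
    {r : Fin k → Fin N} (hr : Function.Injective r) :
    (Fintype.card {s : Fin k → Fin N // Function.Injective s} : ℂ) *
        ∑ π : Equiv.Perm (Fin N), (X.submatrix (π ∘ r) (π ∘ r)).det =
      Fintype.card (Equiv.Perm (Fin N)) * ∑ s : Fin k → Fin N, (X.submatrix s s).det := by
  have h1 (s : Fin k → Fin N) (hs : Function.Injective s) :
      ∑ π : Equiv.Perm (Fin N), (X.submatrix (π ∘ s) (π ∘ s)).det =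
      ∑ π : Equiv.Perm (Fin N), (X.submatrix (π ∘ r) (π ∘ r)).det := by
    -- Permutations act transitively on injective tuples, so all of them have the same orbit sum.
    obtain ⟨ρ, hρ⟩ := Equiv.Perm.exists_extending_pair r s hr hs
    have hs' : s = ρ ∘ r := by ext i; simp [hρ]
    subst hs'
    exact Fintype.sum_equiv (Equiv.mulRight ρ) _ _ fun π => rfl
  have h2 (π : Equiv.Perm (Fin N)) : ∑ s : Fin k → Fin N, (X.submatrix (π ∘ s) (π ∘ s)).det =
      ∑ s : Fin k → Fin N, (X.submatrix s s).det :=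
    Fintype.sum_equiv (Equiv.arrowCongr (Equiv.refl _) π) _ _ fun s => rfl
  calc _ = ∑ s : {s : Fin k → Fin N // Function.Injective s},
        ∑ π : Equiv.Perm (Fin N), (X.submatrix (π ∘ s.1) (π ∘ s.1)).det := by
        simp [h1 _ (Subtype.prop _)]
    _ = ∑ s : Fin k → Fin N, ∑ π : Equiv.Perm (Fin N),
          (X.submatrix (π ∘ s) (π ∘ s)).det := by
        rw [← Finset.sum_filter_of_ne (p := Function.Injective)]
        · rw [Finset.sum_subtype (Finset.univ.filter Function.Injective) (p := Function.Injective)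
            (fun s => by simp)]
        · intro s _ hs
          by_contra hinj
          exact hs (Finset.sum_eq_zero fun π _ =>
            det_submatrix_eq_zero_of_not_injective_left X (fun h => hinj h.of_comp) _)
    _ = _ := by
        rw [Finset.sum_comm]
        simp [h2]

/-- The conjugate of `X` by the signed permutation matrix with signs `ε` and permutation `π`. -/
def signedConj {N : ℕ} (π : Equiv.Perm (Fin N)) (ε : Fin N → ℤˣ) (X : Matrix (Fin N) (Fin N) ℂ) :
    Matrix (Fin N) (Fin N) ℂ :=
  Matrix.of fun i j => ((ε i : ℤ) : ℂ) * (((ε j : ℤ) : ℂ) * X (π i) (π j))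

theorem det_submatrix_signedConj {N k : ℕ} (π : Equiv.Perm (Fin N)) (ε : Fin N → ℤˣ)
    (X : Matrix (Fin N) (Fin N) ℂ) (r c : Fin k → Fin N) :
    ((signedConj π ε X).submatrix r c).det =
      (((∏ i, ε (r i)) * ∏ i, ε (c i) : ℤˣ) : ℤ) * (X.submatrix (π ∘ r) (π ∘ c)).det := by
  have h := Matrix.det_mul_column (fun i => ((ε (r i) : ℤ) : ℂ))
    (Matrix.of fun i j => ((ε (c j) : ℤ) : ℂ) * X.submatrix (π ∘ r) (π ∘ c) i j)
  rw [Matrix.det_mul_row] at h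
  refine Eq.trans ?_ (h.trans ?_)
  · rfl
  · push_cast
    ring

/-- Flipping the sign at `r a` negates the summand: that index occurs once among the rows and never
among the columns. -/
theorem sum_signs_eq_zero {N k : ℕ} {r c : Fin k → Fin N} (hr : Function.Injective r)
    {a : Fin k} (ha : ∀ i, c i ≠ r a) :
    ∑ ε : Fin N → ℤˣ, ((((∏ i, ε (r i)) * ∏ i, ε (c i) : ℤˣ) : ℤ) : ℂ) = 0 := by
  have h : ∑ ε : Fin N → ℤˣ, ((((∏ i, ε (r i)) * ∏ i, ε (c i) : ℤˣ) : ℤ) : ℂ) =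
      ∑ ε : Fin N → ℤˣ, -((((∏ i, ε (r i)) * ∏ i, ε (c i) : ℤˣ) : ℤ) : ℂ) := by
    refine Fintype.sum_equiv (Equiv.mulRight (Pi.mulSingle (r a) (-1 : ℤˣ))) _ _ fun ε => ?_
    have h1 : ∏ i, (Pi.mulSingle (r a) (-1 : ℤˣ) : Fin N → ℤˣ) (r i) = -1 := by
      rw [Fintype.prod_eq_single a]
      · simp
      · intro i hi
        exact Pi.mulSingle_eq_of_ne (hr.ne hi) _
    have h2 : ∏ i, (Pi.mulSingle (r a) (-1 : ℤˣ) : Fin N → ℤˣ) (c i) = 1 :=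
      Finset.prod_eq_one fun i _ => Pi.mulSingle_eq_of_ne (ha i) _
    simp only [Equiv.coe_mulRight, Pi.mul_apply, Finset.prod_mul_distrib, h1, h2]
    push_cast
    ring
  rw [Finset.sum_neg_distrib] at h
  exact self_eq_neg.mp h

/-- The sum over all signed permutation conjugates of a function in the span of the minors is
invariant under conjugation. -/
theorem sum_signedConj_conj {N : ℕ} {f : Matrix (Fin N) (Fin N) ℂ → ℂ} (hf : f ∈ minorSpan N)
    {V W : Matrix (Fin N) (Fin N) ℂ} (hWV : W * V = 1) (X : Matrix (Fin N) (Fin N) ℂ) :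
    ∑ π : Equiv.Perm (Fin N), ∑ ε : Fin N → ℤˣ, f (signedConj π ε (V * X * W)) =
      ∑ π : Equiv.Perm (Fin N), ∑ ε : Fin N → ℤˣ, f (signedConj π ε X) := by
  induction hf using Submodule.span_induction with
  | zero => simp
  | add f g _ _ hf hg => simp only [Pi.add_apply, Finset.sum_add_distrib, hf, hg]
  | smul a f _ hf => simp only [Pi.smul_apply, ← Finset.smul_sum, hf]
  | mem f hf =>
    obtain ⟨k, r, c, rfl⟩ := hf
    simp only [det_submatrix_signedConj, ← Finset.sum_mul]
    by_cases hr : Function.Injective r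
    swap
    · have h (Y) (π : Equiv.Perm (Fin N)) : (Matrix.submatrix Y (π ∘ r) (π ∘ c)).det = (0 : ℂ) :=
        det_submatrix_eq_zero_of_not_injective_left Y (fun h => hr h.of_comp) _
      simp [h]
    by_cases hc : Function.Injective c
    swap
    · have h (Y) (π : Equiv.Perm (Fin N)) : (Matrix.submatrix Y (π ∘ r) (π ∘ c)).det = (0 : ℂ) :=
        det_submatrix_eq_zero_of_not_injective_right Y _ (fun h => hc h.of_comp)
      simp [h]
    -- Either some row index is not a column index and the signs cancel, or `r` is a rearrangement
    -- of `c` and the minor is principal up to sign.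
    by_cases h : ∃ a, ∀ i, c i ≠ r a
    · obtain ⟨a, ha⟩ := h
      simp only [sum_signs_eq_zero hr ha, zero_mul]
    push Not at h
    choose τ hτ using h
    have hτi : Function.Injective τ := fun a b hab => hr (by rw [← hτ, ← hτ, hab])
    obtain ⟨τ, rfl⟩ : ∃ t : Equiv.Perm (Fin k), τ = t :=
      ⟨Equiv.ofBijective τ (Finite.injective_iff_bijective.mp hτi), rfl⟩
    have hr' : r = c ∘ τ := by ext i; simp [hτ]
    have h3 (Y) (π : Equiv.Perm (Fin N)) : (Matrix.submatrix Y (π ∘ r) (π ∘ c)).det =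
        ((Equiv.Perm.sign τ : ℤ) : ℂ) * (Matrix.submatrix Y (π ∘ c) (π ∘ c)).det := by
      rw [hr', ← Matrix.det_permute]
      rfl
    simp only [h3, ← Finset.mul_sum]
    congr 2
    have hcard : (Fintype.card {s : Fin k → Fin N // Function.Injective s} : ℂ) ≠ 0 := by
      have : Nonempty {s : Fin k → Fin N // Function.Injective s} := ⟨⟨c, hc⟩⟩
      exact_mod_cast Fintype.card_ne_zero
    refine mul_left_cancel₀ hcard ?_
    rw [card_mul_sum_perm_principal_minor _ hc, card_mul_sum_perm_principal_minor _ hc,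
      Matrix.mul_assoc, sum_principal_minors_mul_comm, Matrix.mul_assoc, hWV, Matrix.mul_one]

/-! ### Conjugation by unitary and permutation matrices -/

theorem conjBy_unitary {N : ℕ} (u : Matrix.unitaryGroup (Fin N) ℂ)
    (A : Matrix (Fin N) (Fin N) ℂ) :
    conjBy (u : Matrix (Fin N) (Fin N) ℂ) A = u * A * star (u : Matrix (Fin N) (Fin N) ℂ) := by
  rw [conjBy, Matrix.inv_eq_right_inv (Matrix.mem_unitaryGroup_iff.mp u.2)]

theorem conjBy_mul_unitary {N : ℕ} (q u : Matrix.unitaryGroup (Fin N) ℂ)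
    (A : Matrix (Fin N) (Fin N) ℂ) :
    conjBy ((q * u : Matrix.unitaryGroup (Fin N) ℂ) : Matrix (Fin N) (Fin N) ℂ) A =
      conjBy (q : Matrix (Fin N) (Fin N) ℂ) (conjBy (u : Matrix (Fin N) (Fin N) ℂ) A) := by
  simp only [conjBy_unitary]
  simp [Matrix.mul_assoc]

theorem conjBy_permMatrix {N : ℕ} (π : Equiv.Perm (Fin N)) (A : Matrix (Fin N) (Fin N) ℂ) :
    conjBy (π.permMatrix ℂ) A = A.submatrix π π := by
  have h : π.permMatrix ℂ * (π⁻¹).permMatrix ℂ = 1 := by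
    rw [← Matrix.permMatrix_mul]
    simp
  rw [conjBy, Matrix.inv_eq_right_inv h]
  ext i j
  simp [Equiv.Perm.permMatrix, PEquiv.toMatrix_toPEquiv_mul, PEquiv.mul_toMatrix_toPEquiv]
  rfl

/-- The signed permutation matrix with signs `ε` and permutation `π`, as a unitary matrix. -/
def signedPerm {N : ℕ} (π : Equiv.Perm (Fin N)) (ε : Fin N → ℤˣ) :
    Matrix.unitaryGroup (Fin N) ℂ :=
  ⟨Matrix.of fun i j => if π i = j then ((ε i : ℤ) : ℂ) else 0, by
    rw [Matrix.mem_unitaryGroup_iff]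
    ext i j
    rcases eq_or_ne i j with rfl | hij
    · rcases Int.units_eq_one_or (ε i) with h | h <;>
        simp [Matrix.mul_apply, Matrix.star_apply, h]
    · simp [Matrix.mul_apply, Matrix.star_apply, hij, hij.symm]⟩

theorem conjBy_signedPerm {N : ℕ} (π : Equiv.Perm (Fin N)) (ε : Fin N → ℤˣ)
    (X : Matrix (Fin N) (Fin N) ℂ) :
    conjBy (signedPerm π ε : Matrix (Fin N) (Fin N) ℂ) X = signedConj π ε X := by
  rw [conjBy_unitary]
  ext i j
  simp [Matrix.mul_apply, Matrix.star_apply, signedPerm, signedConj, apply_ite (starRingEnd ℂ)]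
  ring

theorem signedConj_of_isDiag {N : ℕ} (π : Equiv.Perm (Fin N)) (ε : Fin N → ℤˣ)
    {A : Matrix (Fin N) (Fin N) ℂ} (hA : A.IsDiag) : signedConj π ε A = A.submatrix π π := by
  ext i j
  rcases eq_or_ne i j with rfl | hij
  · rcases Int.units_eq_one_or (ε i) with h | h <;> simp [signedConj, h]
  · simp [signedConj, hA (π.injective.ne hij)]

/-- The inverse is not continuous at singular matrices, but it is `det⁻¹` times the adjugate, with
`0⁻¹ = 0`. -/
theorem measurable_conjBy {N : ℕ} (A : Matrix (Fin N) (Fin N) ℂ) :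
    Measurable fun V => conjBy V A := by
  have hadj : Measurable fun V : Matrix (Fin N) (Fin N) ℂ => V * A * V.adjugate :=
    ((continuous_id.matrix_mul continuous_const).matrix_mul
      continuous_id.matrix_adjugate).measurable
  have hdet : Measurable fun V : Matrix (Fin N) (Fin N) ℂ => V.det :=
    continuous_id.matrix_det.measurable
  have h : (fun V => conjBy V A) = fun V => V.det⁻¹ • (V * A * V.adjugate) := by
    ext1 V
    rw [conjBy, Matrix.inv_def, Ring.inverse_eq_inv', Matrix.mul_smul]
  rw [h]
  refine measurable_pi_lambda _ fun i => measurable_pi_lambda _ fun j => ?_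
  exact hdet.inv.mul ((measurable_pi_apply j).comp ((measurable_pi_apply i).comp hadj))

theorem continuous_conjBy_unitary {N : ℕ} (A : Matrix (Fin N) (Fin N) ℂ) :
    Continuous fun u : Matrix.unitaryGroup (Fin N) ℂ => conjBy (u : Matrix (Fin N) (Fin N) ℂ) A := by
  simp only [conjBy_unitary]
  exact (continuous_subtype_val.matrix_mul continuous_const).matrix_mul
    continuous_subtype_val.star

/-! ### Equality of means for a single matrix -/

instance isProbabilityMeasure_haarMeasure_top (N : ℕ) :
    IsProbabilityMeasure (Measure.haarMeasure
      (⊤ : TopologicalSpace.PositiveCompacts (Matrix.unitaryGroup (Fin N) ℂ))) :=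
  ⟨Measure.haarMeasure_self (K₀ :=
    (⊤ : TopologicalSpace.PositiveCompacts (Matrix.unitaryGroup (Fin N) ℂ)))⟩

theorem integral_map_conjBy_haarUnitaryLaw {N : ℕ} {f : Matrix (Fin N) (Fin N) ℂ → ℂ}
    (hf : Continuous f) (A : Matrix (Fin N) (Fin N) ℂ) :
    ∫ X, f X ∂((haarUnitaryLaw N).map fun V => conjBy V A) =
      ∫ u : Matrix.unitaryGroup (Fin N) ℂ, f (conjBy (u : Matrix (Fin N) (Fin N) ℂ) A)
        ∂(Measure.haarMeasure ⊤) := by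
  rw [integral_map (measurable_conjBy A).aemeasurable hf.aestronglyMeasurable, haarUnitaryLaw,
    integral_map measurable_subtype_coe.aemeasurable]
  exact (hf.measurable.comp (measurable_conjBy A)).aestronglyMeasurable

theorem integral_map_conjBy_uniformPermLaw {N : ℕ} {f : Matrix (Fin N) (Fin N) ℂ → ℂ}
    (hf : Continuous f) (A : Matrix (Fin N) (Fin N) ℂ) :
    ∫ X, f X ∂((uniformPermLaw N).map fun V => conjBy V A) =
      (N.factorial : ℂ)⁻¹ * ∑ π : Equiv.Perm (Fin N), f (A.submatrix π π) := by
  rw [integral_map (measurable_conjBy A).aemeasurable hf.aestronglyMeasurable, uniformPermLaw,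
    integral_smul_measure, integral_finsetSum_measure fun π _ => integrable_dirac (by simp)]
  simp_rw [integral_dirac, conjBy_permMatrix]
  simp

/-- A function in the span of the minors has the same mean over the unitary conjugates of a
diagonal matrix as over its permutation conjugates. -/
theorem integral_haarUnitaryLaw_eq_uniformPermLaw {N : ℕ} {f : Matrix (Fin N) (Fin N) ℂ → ℂ}
    (hf : f ∈ minorSpan N) {A : Matrix (Fin N) (Fin N) ℂ} (hA : A.IsDiag) :
    ∫ X, f X ∂((haarUnitaryLaw N).map fun V => conjBy V A) =
      ∫ X, f X ∂((uniformPermLaw N).map fun V => conjBy V A) := by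
  have hc := continuous_of_mem_minorSpan hf
  rw [integral_map_conjBy_haarUnitaryLaw hc, integral_map_conjBy_uniformPermLaw hc]
  set H := Measure.haarMeasure
    (⊤ : TopologicalSpace.PositiveCompacts (Matrix.unitaryGroup (Fin N) ℂ)) with hH
  set I := ∫ u : Matrix.unitaryGroup (Fin N) ℂ, f (conjBy (u : Matrix (Fin N) (Fin N) ℂ) A) ∂H
  have hshift (π : Equiv.Perm (Fin N)) (ε : Fin N → ℤˣ) :
      ∫ u : Matrix.unitaryGroup (Fin N) ℂ,
        f (signedConj π ε (conjBy (u : Matrix (Fin N) (Fin N) ℂ) A)) ∂H = I := by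
    simp_rw [← conjBy_signedPerm, ← conjBy_mul_unitary]
    exact integral_mul_left_eq_self
      (fun u : Matrix.unitaryGroup (Fin N) ℂ => f (conjBy (u : Matrix (Fin N) (Fin N) ℂ) A)) _
  have hint (π : Equiv.Perm (Fin N)) (ε : Fin N → ℤˣ) :
      Integrable (fun u : Matrix.unitaryGroup (Fin N) ℂ =>
        f (signedConj π ε (conjBy (u : Matrix (Fin N) (Fin N) ℂ) A))) H := by
    simp_rw [← conjBy_signedPerm, ← conjBy_mul_unitary]
    have h := (hc.comp ((continuous_conjBy_unitary A).comp
      (continuous_const_mul (signedPerm π ε))))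
    exact h.integrable_of_hasCompactSupport (HasCompactSupport.of_compactSpace _)
  have hsum : ∑ π : Equiv.Perm (Fin N), ∑ ε : Fin N → ℤˣ, I =
      ∑ π : Equiv.Perm (Fin N), ∑ ε : Fin N → ℤˣ, f (A.submatrix π π) := by
    calc _ = ∑ π : Equiv.Perm (Fin N), ∑ ε : Fin N → ℤˣ, ∫ u : Matrix.unitaryGroup (Fin N) ℂ,
          f (signedConj π ε (conjBy (u : Matrix (Fin N) (Fin N) ℂ) A)) ∂H := by simp_rw [hshift]
      _ = ∫ u : Matrix.unitaryGroup (Fin N) ℂ, ∑ π : Equiv.Perm (Fin N), ∑ ε : Fin N → ℤˣ,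
          f (signedConj π ε (conjBy (u : Matrix (Fin N) (Fin N) ℂ) A)) ∂H := by
        rw [integral_finsetSum _ fun π _ => integrable_finsetSum _ fun ε _ => hint π ε]
        simp_rw [integral_finsetSum _ fun ε _ => hint _ ε]
      _ = _ := by
        -- Conjugation invariance removes `u`, so a constant is integrated against a probability
        -- measure.
        simp_rw [conjBy_unitary, sum_signedConj_conj hf
          (Matrix.mem_unitaryGroup_iff'.mp (Subtype.prop _)), signedConj_of_isDiag _ _ hA]
        simp
  simp only [Finset.sum_const, Finset.card_univ, Fintype.card_perm,
    Fintype.card_fin, nsmul_eq_mul, ← Finset.mul_sum] at hsum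
  rw [mul_left_comm] at hsum
  have hN : (N.factorial : ℂ) ≠ 0 := by exact_mod_cast N.factorial_ne_zero
  have hcard : (Fintype.card (Fin N → ℤˣ) : ℂ) ≠ 0 := by exact_mod_cast Fintype.card_ne_zero
  rw [← mul_left_cancel₀ hcard hsum, inv_mul_cancel_left₀ hN]

/-! ### Exchanging the factors of a product measure -/

/-- A continuous function is integrable for a finite measure carried by a compact set. -/
theorem Continuous.integrable_of_ae_mem_isCompact {E : Type*} [TopologicalSpace E] [T2Space E]
    [MeasurableSpace E] [OpensMeasurableSpace E] {μ : Measure E} [IsFiniteMeasure μ] {K : Set E}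
    (hK : IsCompact K) (hμ : ∀ᵐ x ∂μ, x ∈ K) {F : E → ℂ} (hF : Continuous F) :
    Integrable F μ := by
  rw [← Measure.restrict_eq_self_of_ae_mem hμ]
  exact hF.continuousOn.integrableOn_compact hK

theorem ae_pi_mem_isCompact {E : Type*} [TopologicalSpace E] [MeasurableSpace E]
    {ι : Type*} [Fintype ι] (μ : ι → Measure E) [∀ i, IsProbabilityMeasure (μ i)]
    (hμ : ∀ i, ∃ K, IsCompact K ∧ ∀ᵐ x ∂(μ i), x ∈ K) :
    ∃ K, IsCompact K ∧ ∀ᵐ x ∂(Measure.pi μ), x ∈ K := by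
  choose K hK hμK using hμ
  refine ⟨Set.univ.pi K, isCompact_univ_pi hK, ?_⟩
  have h : ∀ i, ∀ᵐ x ∂(Measure.pi μ), x i ∈ K i := fun i =>
    (Measure.quasiMeasurePreserving_eval μ i).ae (hμK i)
  filter_upwards [ae_all_iff.mpr h] with x hx i _ using hx i

/-- Two product measures with compactly carried factors agree on every continuous function that
lies, in each variable separately, in a class of functions on which the factors agree. -/
theorem integral_pi_eq_of_separately {E : Type*} [TopologicalSpace E] [T2Space E]
    [SecondCountableTopology E] [MeasurableSpace E] [BorelSpace E] (D : Set (E → ℂ)) (n : ℕ)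
    (μ ν : Fin n → Measure E) [∀ i, IsProbabilityMeasure (μ i)] [∀ i, IsProbabilityMeasure (ν i)]
    (hμ : ∀ i, ∃ K, IsCompact K ∧ ∀ᵐ x ∂(μ i), x ∈ K)
    (hν : ∀ i, ∃ K, IsCompact K ∧ ∀ᵐ x ∂(ν i), x ∈ K)
    (h : ∀ i, ∀ f ∈ D, ∫ x, f x ∂(μ i) = ∫ x, f x ∂(ν i)) {F : (Fin n → E) → ℂ}
    (hF : Continuous F) (hFD : ∀ i y, (fun x => F (Function.update y i x)) ∈ D) :
    ∫ y, F y ∂(Measure.pi μ) = ∫ y, F y ∂(Measure.pi ν) := by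
  induction n with
  | zero =>
    have : μ = ν := Subsingleton.elim _ _
    rw [this]
  | succ n ih =>
    have hprod (ρ : Fin (n + 1) → Measure E) [∀ i, IsProbabilityMeasure (ρ i)] :
        ∫ y, F y ∂(Measure.pi ρ) =
          ∫ p : E × (Fin n → E), F (Fin.cons p.1 p.2)
            ∂((ρ 0).prod (Measure.pi fun i => ρ i.succ)) := by
      rw [← (measurePreserving_piFinSuccAbove ρ 0).symm.integral_comp' F]
      simp [MeasurableEquiv.piFinSuccAbove, Fin.insertNthEquiv]
    have hcons : Continuous fun p : E × (Fin n → E) => F (Fin.cons p.1 p.2) := by fun_prop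
    have hint (α : Measure E) [IsProbabilityMeasure α] (hα : ∃ K, IsCompact K ∧ ∀ᵐ x ∂α, x ∈ K)
        (ρ : Fin n → Measure E) [∀ i, IsProbabilityMeasure (ρ i)]
        (hρ : ∀ i, ∃ K, IsCompact K ∧ ∀ᵐ x ∂(ρ i), x ∈ K) :
        Integrable (fun p : E × (Fin n → E) => F (Fin.cons p.1 p.2)) (α.prod (Measure.pi ρ)) := by
      obtain ⟨K, hK, hKα⟩ := hα
      obtain ⟨L, hL, hLρ⟩ := ae_pi_mem_isCompact ρ hρ
      refine hcons.integrable_of_ae_mem_isCompact (hK.prod hL) ?_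
      filter_upwards [Measure.quasiMeasurePreserving_fst.ae hKα,
        Measure.quasiMeasurePreserving_snd.ae hLρ] with p h1 h2 using ⟨h1, h2⟩
    have ihx (x : E) : ∫ y, F (Fin.cons x y) ∂(Measure.pi fun i => μ i.succ) =
        ∫ y, F (Fin.cons x y) ∂(Measure.pi fun i => ν i.succ) := by
      refine ih (fun i => μ i.succ) (fun i => ν i.succ) (fun i => hμ _) (fun i => hν _)
        (fun i => h _) (F := fun y => F (Fin.cons x y)) (by fun_prop) fun i y => ?_
      simpa only [Fin.cons_update] using hFD i.succ (Fin.cons x y)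
    have h0 (y : Fin n → E) : ∫ x, F (Fin.cons x y) ∂(μ 0) = ∫ x, F (Fin.cons x y) ∂(ν 0) := by
      -- The point `x₀` only fills slot `0`, which the update overwrites.
      obtain hE | ⟨⟨x₀⟩⟩ := isEmpty_or_nonempty E
      · simp [integral_of_isEmpty]
      · refine h 0 _ ?_
        simpa only [Fin.update_cons_zero] using hFD 0 (Fin.cons x₀ y)
    calc ∫ y, F y ∂(Measure.pi μ)
        = ∫ x, ∫ y, F (Fin.cons x y) ∂(Measure.pi fun i => μ i.succ) ∂(μ 0) := by
          rw [hprod, integral_prod _ (hint _ (hμ 0) _ fun i => hμ i.succ)]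
      _ = ∫ x, ∫ y, F (Fin.cons x y) ∂(Measure.pi fun i => ν i.succ) ∂(μ 0) := by
          simp_rw [ihx]
      _ = ∫ y, ∫ x, F (Fin.cons x y) ∂(μ 0) ∂(Measure.pi fun i => ν i.succ) :=
          integral_integral_swap (hint _ (hμ 0) _ fun i => hν i.succ)
      _ = ∫ y, ∫ x, F (Fin.cons x y) ∂(ν 0) ∂(Measure.pi fun i => ν i.succ) := by
          simp_rw [h0]
      _ = ∫ y, F y ∂(Measure.pi ν) := by
          rw [hprod, integral_prod_symm _ (hint _ (hν 0) _ fun i => hν i.succ)]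

/-! ### Joint laws of the random conjugates -/

instance secondCountableTopology_matrix (N : ℕ) :
    SecondCountableTopology (Matrix (Fin N) (Fin N) ℂ) :=
  inferInstanceAs (SecondCountableTopology (Fin N → Fin N → ℂ))

theorem ae_mem_isCompact_map_conjBy_haarUnitaryLaw {N : ℕ} (A : Matrix (Fin N) (Fin N) ℂ) :
    ∃ K, IsCompact K ∧ ∀ᵐ X ∂((haarUnitaryLaw N).map fun V => conjBy V A), X ∈ K := by
  have hK := isCompact_range (continuous_conjBy_unitary A)
  refine ⟨_, hK, ?_⟩
  rw [haarUnitaryLaw, Measure.map_map (measurable_conjBy A) measurable_subtype_coe]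
  refine (ae_map_iff ((measurable_conjBy A).comp measurable_subtype_coe).aemeasurable
    hK.measurableSet).mpr ?_
  exact Filter.Eventually.of_forall fun u => Set.mem_range_self u

theorem ae_mem_isCompact_map_conjBy_uniformPermLaw {N : ℕ} (A : Matrix (Fin N) (Fin N) ℂ) :
    ∃ K, IsCompact K ∧ ∀ᵐ X ∂((uniformPermLaw N).map fun V => conjBy V A), X ∈ K := by
  have hK : IsCompact (Set.range fun π : Equiv.Perm (Fin N) => conjBy (π.permMatrix ℂ) A) :=
    (Set.finite_range _).isCompact
  refine ⟨_, hK, ?_⟩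
  refine (ae_map_iff (measurable_conjBy A).aemeasurable hK.measurableSet).mpr ?_
  rw [uniformPermLaw]
  refine Measure.ae_smul_measure ?_ _
  rw [ae_iff, Measure.finsetSum_apply]
  refine Finset.sum_eq_zero fun π _ => ?_
  rw [← ae_iff]
  refine (ae_dirac_iff (measurable_conjBy A hK.measurableSet)).mpr ?_
  exact Set.mem_range_self π

theorem map_conjBy_eq_pi {Ω : Type*} [MeasurableSpace Ω] {P : Measure Ω} [IsProbabilityMeasure P]
    {N d : ℕ} {V : Fin d → Ω → Matrix (Fin N) (Fin N) ℂ} {ℓ : Measure (Matrix (Fin N) (Fin N) ℂ)}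
    (hV : ∀ j, HasLaw (V j) ℓ P) (hindep : iIndepFun V P) (A : Fin d → Matrix (Fin N) (Fin N) ℂ) :
    P.map (fun ω j => conjBy (V j ω) (A j)) =
      Measure.pi fun j => ℓ.map fun W => conjBy W (A j) := by
  have h := hindep.comp (fun j W => conjBy W (A j)) fun j => measurable_conjBy (A j)
  have hm (j) : AEMeasurable (fun ω => conjBy (V j ω) (A j)) P :=
    (measurable_conjBy (A j)).comp_aemeasurable (hV j).aemeasurable
  refine ((iIndepFun_iff_map_fun_eq_pi_map hm).mp h).trans ?_
  congr 1
  ext1 j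
  rw [← (hV j).map_eq,
    AEMeasurable.map_map_of_aemeasurable (measurable_conjBy (A j)).aemeasurable (hV j).aemeasurable]
  rfl

/-- A continuous function of the conjugates that lies in the span of the minors in each variable
separately has the same expectation for Haar unitary and for uniform permutation matrices. -/
theorem sameExpectation_of_separately_mem_minorSpan {Ω : Type*} [MeasurableSpace Ω]
    (P : Measure Ω) [IsProbabilityMeasure P] {N d : ℕ}
    {S U : Fin d → Ω → Matrix (Fin N) (Fin N) ℂ}
    (hS : ∀ j, HasLaw (S j) (uniformPermLaw N) P) (hU : ∀ j, HasLaw (U j) (haarUnitaryLaw N) P)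
    (hSi : iIndepFun S P) (hUi : iIndepFun U P)
    {A : Fin d → Matrix (Fin N) (Fin N) ℂ} (hA : ∀ j, (A j).IsDiag)
    {F : (Fin d → Matrix (Fin N) (Fin N) ℂ) → ℂ} (hF : Continuous F)
    (hFD : ∀ i y, (fun X => F (Function.update y i X)) ∈ minorSpan N) :
    SameExpectation P (fun ω => F fun j => conjBy (U j ω) (A j))
      (fun ω => F fun j => conjBy (S j ω) (A j)) := by
  have hprob {V : Fin d → Ω → Matrix (Fin N) (Fin N) ℂ}
      {ℓ : Measure (Matrix (Fin N) (Fin N) ℂ)} (hV : ∀ j, HasLaw (V j) ℓ P) (j : Fin d) :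
      IsProbabilityMeasure (ℓ.map fun W => conjBy W (A j)) := by
    have : IsProbabilityMeasure ℓ := by
      rw [← (hV j).map_eq]
      exact Measure.isProbabilityMeasure_map (hV j).aemeasurable
    exact Measure.isProbabilityMeasure_map (measurable_conjBy (A j)).aemeasurable
  have hm {V : Fin d → Ω → Matrix (Fin N) (Fin N) ℂ}
      {ℓ : Measure (Matrix (Fin N) (Fin N) ℂ)} (hV : ∀ j, HasLaw (V j) ℓ P) :
      AEMeasurable (fun ω j => conjBy (V j ω) (A j)) P :=
    aemeasurable_pi_lambda _ fun j =>
      (measurable_conjBy (A j)).comp_aemeasurable (hV j).aemeasurable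
  have hpU := hprob hU
  have hpS := hprob hS
  have hKU (j : Fin d) := ae_mem_isCompact_map_conjBy_haarUnitaryLaw (A j)
  have hKS (j : Fin d) := ae_mem_isCompact_map_conjBy_uniformPermLaw (A j)
  refine ⟨?_, ?_, ?_⟩
  · obtain ⟨K, hK, hμ⟩ := ae_pi_mem_isCompact _ hKU
    have := hF.integrable_of_ae_mem_isCompact hK hμ
    rw [← map_conjBy_eq_pi hU hUi] at this
    exact this.comp_aemeasurable (hm hU)
  · obtain ⟨K, hK, hμ⟩ := ae_pi_mem_isCompact _ hKS
    have := hF.integrable_of_ae_mem_isCompact hK hμ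
    rw [← map_conjBy_eq_pi hS hSi] at this
    exact this.comp_aemeasurable (hm hS)
  · rw [← integral_map (hm hU) hF.aestronglyMeasurable,
      ← integral_map (hm hS) hF.aestronglyMeasurable, map_conjBy_eq_pi hU hUi,
      map_conjBy_eq_pi hS hSi]
    exact integral_pi_eq_of_separately (minorSpan N : Set _) d _ _ hKU hKS
      (fun i f hf => integral_haarUnitaryLaw_eq_uniformPermLaw hf (hA i)) hF hFD

/-! ### The three characteristic polynomials -/

theorem continuous_charDet {n : ℕ} (z : ℂ) :
    Continuous (charDet z : Matrix (Fin n) (Fin n) ℂ → ℂ) :=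
  (continuous_const.sub continuous_id).matrix_det

theorem charDet_add_mul_mul_mem_minorSpan {N n : ℕ} (z : ℂ) (B : Matrix (Fin n) (Fin n) ℂ)
    (C : Matrix (Fin n) (Fin N) ℂ) (R : Matrix (Fin N) (Fin n) ℂ) :
    (fun X : Matrix (Fin N) (Fin N) ℂ => charDet z (B + C * X * R)) ∈ minorSpan N := by
  convert det_add_mul_mul_mem_minorSpan (z • 1 - B) (-C) R using 2 with X
  rw [charDet, Matrix.neg_mul, Matrix.neg_mul]
  congr 1
  abel

theorem exists_prod_ofFn_update {M : Type*} [Monoid M] {d : ℕ} (y : Fin d → M) (i : Fin d) :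
    ∃ l r : M, ∀ x, (List.ofFn (Function.update y i x)).prod = l * x * r := by
  induction d with
  | zero => exact i.elim0
  | succ d ih =>
    refine Fin.cases ?_ (fun i => ?_) i
    · refine ⟨1, (List.ofFn fun j => y (Fin.succ j)).prod, fun x => ?_⟩
      simp [List.ofFn_succ]
    · obtain ⟨l, r, h⟩ := ih (fun j => y j.succ) i
      refine ⟨y 0 * l, r, fun x => ?_⟩
      have hu : (fun j : Fin d => Function.update y i.succ x j.succ) =
          Function.update (fun j => y j.succ) i x :=
        Function.update_comp_eq_of_injective' y (Fin.succ_injective d) i x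
      rw [List.ofFn_succ, List.prod_cons, hu, h]
      simp [mul_assoc, Function.update_of_ne (Fin.succ_ne_zero i).symm]

theorem continuous_prod_ofFn {M : Type*} [Monoid M] [TopologicalSpace M] [ContinuousMul M]
    (d : ℕ) : Continuous fun y : Fin d → M => (List.ofFn y).prod := by
  induction d with
  | zero => simpa using continuous_const
  | succ d ih =>
    simp only [List.ofFn_succ, List.prod_cons]
    exact (continuous_apply 0).mul (ih.comp (by fun_prop))

theorem proposition3p2 {Ω : Type*} [MeasurableSpace Ω] (P : Measure Ω) [IsProbabilityMeasure P]
    (N d : ℕ) (S U : Fin d → Ω → Matrix (Fin N) (Fin N) ℂ)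
    (hS : ∀ j, HasLaw (S j) (uniformPermLaw N) P)
    (hU : ∀ j, HasLaw (U j) (haarUnitaryLaw N) P)
    (hindep : iIndepFun (Sum.elim S U) P)
    (A : Fin d → Matrix (Fin N) (Fin N) ℂ) (hA : ∀ j, (A j).IsDiag) (z : ℂ) :
    SameExpectation P
      (fun ω => charDet z (∑ j, conjBy (U j ω) (A j)))
      (fun ω => charDet z (∑ j, conjBy (S j ω) (A j))) ∧
    SameExpectation P
      (fun ω => charDet z (List.ofFn fun j => conjBy (U j ω) (A j)).prod)
      (fun ω => charDet z (List.ofFn fun j => conjBy (S j ω) (A j)).prod) ∧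
    ∀ (j : Fin d) (k : ℕ) (hk : k ≤ N),
      SameExpectation P
        (fun ω => charDet z (topLeft hk (conjBy (U j ω) (A j))))
        (fun ω => charDet z (topLeft hk (conjBy (S j ω) (A j)))) := by
  have hSi : iIndepFun S P := hindep.precomp (g := Sum.inl) Sum.inl_injective
  have hUi : iIndepFun U P := hindep.precomp (g := Sum.inr) Sum.inr_injective
  refine ⟨?_, ?_, fun j k hk => ?_⟩
  · refine sameExpectation_of_separately_mem_minorSpan P hS hU hSi hUi hA
      (F := fun y => charDet z (∑ j, y j))
      ((continuous_charDet z).comp (continuous_finsetSum _ fun j _ => continuous_apply j))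
      fun i y => ?_
    convert charDet_add_mul_mul_mem_minorSpan z (∑ j ∈ Finset.univ \ {i}, y j)
      (1 : Matrix (Fin N) (Fin N) ℂ) 1 using 3 with X
    rw [Finset.sum_update_of_mem (Finset.mem_univ i)]
    simp [add_comm]
  · refine sameExpectation_of_separately_mem_minorSpan P hS hU hSi hUi hA
      (F := fun y => charDet z (List.ofFn y).prod)
      ((continuous_charDet z).comp (continuous_prod_ofFn d)) fun i y => ?_
    obtain ⟨l, r, h⟩ := exists_prod_ofFn_update y i
    convert charDet_add_mul_mul_mem_minorSpan z 0 l r using 3 with X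
    rw [h, zero_add]
  · refine sameExpectation_of_separately_mem_minorSpan P hS hU hSi hUi hA
      (F := fun y => charDet z (topLeft hk (y j)))
      ((continuous_charDet z).comp ((continuous_apply j).matrix_submatrix _ _)) fun i y => ?_
    rcases eq_or_ne j i with rfl | hij
    -- The corner is `C * X * R` with `C` and `R` the truncated identities.
    · convert charDet_add_mul_mul_mem_minorSpan z 0
        ((1 : Matrix (Fin N) (Fin N) ℂ).submatrix (Fin.castLE hk) id)
        ((1 : Matrix (Fin N) (Fin N) ℂ).submatrix id (Fin.castLE hk)) using 3 with X
      ext a b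
      simp [topLeft, Matrix.mul_apply, Matrix.one_apply]
    -- Here the function is constant in `X`, hence `C = R = 0`.
    · convert charDet_add_mul_mul_mem_minorSpan z (topLeft hk (y j))
        (0 : Matrix (Fin k) (Fin N) ℂ) 0 using 3 with X
      simp [Function.update_of_ne hij]
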